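/- Let $\mathfrak{c} = 2^{\aleph_0}$ and let $\eta$ be the Euclidean topology on $\mathbb{R}$. A topology $\tau \supseteq \eta$ on $\mathbb{R}$ is called strictly finer than $\eta$ at a point $x$ if the neighborhood filters of $x$ with respect to $\tau$ and $\eta$ are different. **Theorem 6.** There exists a set $\mathcal{S}$ of topologies on $\mathbb{R}$ of cardinality $|\mathcal{S}| = 2^{2^{\mathfrak{c}}}$ such that 1. every $\tau \in \mathcal{S}$ is finer than $\eta$ and is strictly finer than $\eta$ at every point $x \in \mathbb{R}$; 2. for every $\tau \in \mathcal{S}$ the space $(\mathbb{R}, \tau)$ is Hausdorff, separable and connected; 3. the spaces $(\mathbb{R}, \tau)$, $\tau \in \mathcal{S}$, are incomparable: whenever $\tau, \sigma \in \mathcal{S}$ and $(\mathbb{R}, \tau)$ is homeomorphic to a subspace $S$ of $(\mathbb{R}, \sigma)$, then $\tau = \sigma$ and $S = \mathbb{R}$. In other words, the spaces are mutually non-homeomorphic, and none of them is homeomorphic to a proper subspace of itself or of any other of them. -/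

import Mathlib

/-- The natural Euclidean topology `η` on the real line. -/
abbrev euclideanTopology : TopologicalSpace ℝ := inferInstance

/-- The family of all topologies on `ℝ` that are finer than the Euclidean topology
(every Euclidean open set is open). -/
def refinements : Set (TopologicalSpace ℝ) :=
  {τ | ∀ U : Set ℝ, @IsOpen ℝ euclideanTopology U → @IsOpen ℝ τ U}

/-- `Γ(τ)`: the set of all points at which the neighbourhood filter of `τ` differs from the
Euclidean one. For `τ` in `refinements` these are the points at which `τ` is strictly finer than
the Euclidean topology. -/
def strictPoints (τ : TopologicalSpace ℝ) : Set ℝ :=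
  {x | @nhds ℝ euclideanTopology x ≠ @nhds ℝ τ x}

/-- The spaces `(X, τ)`, `τ ∈ 𝒮`, are incomparable: for `τ, σ ∈ 𝒮` the space `(X, τ)` is
homeomorphic to a subspace `S` of `(X, σ)` only in the trivial case that `τ = σ` and `S` is the
whole space. -/
def Incomparable {X : Type*} (𝒮 : Set (TopologicalSpace X)) : Prop :=
  ∀ τ ∈ 𝒮, ∀ σ ∈ 𝒮, ∀ S : Set X,
    Nonempty (@Homeomorph X S τ (TopologicalSpace.induced (Subtype.val : S → X) σ)) →
      τ = σ ∧ S = Set.univ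

open Set Filter Topology Function

/-! All topologies share one dense set `D` with `0 ∉ D` and dense complement: near `x ≠ 0` only
traces on `D ∪ {x}` matter, so separability and connectedness come from the Euclidean line. At `0` a
filter `G → 0` living off `D` is added; it can be recovered from the topology (`le_of_eq`), and
there are `2 ^ 2 ^ 𝔠` choices. Continuous maps between these spaces are Euclidean continuous, so
only `𝔠` maps compete. Transfinite recursion makes `D` defeat every injective one except the
identity (`exists_rigid_set`). An embedding is then the identity, which forces equal topologies and
full image. -/

/-! ### Transfinite choice -/

open Cardinal in
/-- Transfinite choice: pick points from large sets, each pick avoiding countably many conflicts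
with every earlier pick. -/
theorem exists_choice_avoiding {ι α : Type} {κ : Cardinal.{0}} (hκ : ℵ₀ < κ) (hι : #ι ≤ κ)
    (P B : ι → Set α) (hP : ∀ i, κ ≤ #(P i)) (hB : ∀ i, (B i).Countable)
    (C : ι → ι → α → Set α) (hC : ∀ i j y, (C i j y).Countable) :
    ∃ z : ι → α, (∀ i, z i ∈ P i \ B i) ∧
      ∀ i j, i ≠ j → z i ∉ C i j (z j) ∨ z j ∉ C j i (z i) := by
  -- In a well-order of least type every initial segment has fewer than `κ` elements, so the earlier
  -- picks exclude fewer than `κ` points.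
  obtain ⟨r, wo, hr⟩ := exists_ord_eq ι
  have step : ∀ (i : ι) (g : ∀ j, r j i → α),
      ∃ x ∈ P i \ B i, ∀ j (h : r j i), x ∉ C i j (g j h) := by
    intro i g
    by_contra! hcon
    have hsub : P i ⊆ B i ∪ ⋃ j : {j // r j i}, C i j.1 (g j.1 j.2) := by
      intro x hx
      by_cases hxB : x ∈ B i
      · exact Or.inl hxB
      · obtain ⟨j, h, hj⟩ := hcon x ⟨hx, hxB⟩
        exact Or.inr (mem_iUnion.2 ⟨⟨j, h⟩, hj⟩)
    have hlt : #{j // r j i} < κ := by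
      have := card_typein_lt i hr
      exact lt_of_lt_of_le this hι
    have h1 : #(⋃ j : {j // r j i}, C i j.1 (g j.1 j.2)) ≤ #{j // r j i} * ℵ₀ := by
      refine mk_iUnion_le_sum_mk.trans ?_
      calc Cardinal.sum (fun j : {j // r j i} => #(C i j.1 (g j.1 j.2)))
          ≤ Cardinal.sum (fun _ : {j // r j i} => ℵ₀) :=
            sum_le_sum _ _ fun j => le_aleph0_iff_set_countable.2 (hC _ _ _)
        _ = _ := by simp
    have h2 : κ ≤ ℵ₀ + #{j // r j i} * ℵ₀ :=
      (hP i).trans ((mk_le_mk_of_subset hsub).trans ((mk_union_le _ _).trans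
        (add_le_add (le_aleph0_iff_set_countable.2 (hB i)) h1)))
    exact absurd h2 (not_le.2 (add_lt_of_lt hκ.le hκ (mul_lt_of_lt hκ.le hlt hκ)))
  choose s hs hs' using step
  let z : ι → α := (wo.wf : WellFounded r).fix fun i ih => s i ih
  have hz : ∀ i, z i = s i fun j _ => z j := fun i => WellFounded.fix_eq _ _ i
  refine ⟨z, fun i => by rw [hz]; exact hs _ _, fun i j hij => ?_⟩
  have key : ∀ i j, r j i → z i ∉ C i j (z j) := by
    intro i j h
    have := hs' i (fun j _ => z j) j h
    rwa [← hz] at this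
  rcases trichotomous_of r i j with h | h | h
  · exact Or.inr (key j i h)
  · exact absurd h hij
  · exact Or.inl (key i j h)

open Cardinal in
theorem mk_continuousMap_real_le : #C(ℝ, ℝ) ≤ 𝔠 := by
  have hinj : Injective fun (f : C(ℝ, ℝ)) (q : ℚ) => f (q : ℝ) := by
    intro f g h
    ext x
    exact congrFun (Rat.denseRange_cast.equalizer f.continuous g.continuous h) x
  refine (mk_le_of_injective hinj).trans ?_
  simp [mk_real]

/-! ### The rigid set -/

/-- A task for the construction of a rigid set: a continuous injection without fixed points
on a nonempty open interval. -/
structure DisplacingMap where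
  toMap : C(ℝ, ℝ)
  left : ℝ
  right : ℝ
  injective : Injective toMap
  left_lt_right : left < right
  ne_self : ∀ x ∈ Ioo left right, toMap x ≠ x

namespace DisplacingMap

open Cardinal in
theorem mk_le : #DisplacingMap ≤ 𝔠 := by
  have hinj : Injective fun i : DisplacingMap => (i.toMap, i.left, i.right) := by
    rintro ⟨f, a, b, _, _, _⟩ ⟨g, c, d, _, _, _⟩ h
    simp only [Prod.mk.injEq] at h
    obtain ⟨rfl, rfl, rfl⟩ := h
    rfl
  refine (mk_le_of_injective hinj).trans ?_
  simp only [mk_prod, lift_id, mk_real, continuum_mul_self]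
  exact (mul_le_mul_left mk_continuousMap_real_le _).trans_eq continuum_mul_self

/-- Translation by `t ≠ 0` on the interval `(a, b)`. -/
def translation (t a b : ℝ) (ht : t ≠ 0) (hab : a < b) : DisplacingMap where
  toMap := ⟨fun x => x + t, by fun_prop⟩
  left := a
  right := b
  injective := fun x y h => by simpa using h
  left_lt_right := hab
  ne_self := fun x _ => by simpa using ht

end DisplacingMap

/-- Every task is realised by a pair `(z i, f i (z i))` of nonzero points, and no two of these
pairs meet. -/
theorem exists_disjoint_pairs :
    ∃ z : DisplacingMap → ℝ,
      (∀ i, z i ∈ Ioo i.left i.right ∧ z i ≠ 0 ∧ i.toMap (z i) ≠ 0) ∧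
      ∀ i j, i ≠ j → z i ≠ j.toMap (z j) ∧ i.toMap (z i) ≠ j.toMap (z j) := by
  obtain ⟨z, hz, hz'⟩ := exists_choice_avoiding (ι := DisplacingMap) Cardinal.aleph0_lt_continuum
    DisplacingMap.mk_le
    (fun i => Ioo i.left i.right) (fun i => {0} ∪ i.toMap ⁻¹' {0})
    (fun i => (Cardinal.mk_Ioo_real i.left_lt_right).ge)
    (fun i => (countable_singleton _).union
      ((countable_singleton _).preimage i.injective))
    -- The conflicts include both cross-coincidences, so avoidance by the later pick alone suffices.
    (fun i j y => {j.toMap y} ∪ i.toMap ⁻¹' {y, j.toMap y})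
    (fun i j y => (countable_singleton _).union
      (((countable_singleton _).insert _).preimage i.injective))
  refine ⟨z, fun i => ?_, fun i j hij => ?_⟩
  · have := hz i
    simp only [Set.mem_sdiff, mem_union, mem_singleton_iff, mem_preimage, not_or] at this
    exact this
  · have := hz' i j hij
    simp only [mem_union, mem_singleton_iff, mem_preimage, mem_insert_iff, not_or] at this
    rcases this with ⟨h1, h2, h3⟩ | ⟨h1, h2, h3⟩
    · exact ⟨h1, h3⟩
    · exact ⟨fun h => h2 h.symm, fun h => h3 h.symm⟩

/-- There is a set of reals mapped into itself, even locally and up to the point `0`, by no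
continuous injection of the line other than the identity; moreover the complement contains
continuum many points arbitrarily close to `0`. -/
theorem exists_rigid_set :
    ∃ D : Set ℝ, (0 : ℝ) ∉ D ∧
      (∀ f : ℝ → ℝ, Continuous f → Injective f → ∀ a b, a < b → (∀ x ∈ Ioo a b, f x ≠ x) →
        ∃ x ∈ Ioo a b, x ∈ D ∧ f x ∉ D ∧ f x ≠ 0) ∧
      ∃ φ : ℕ × ℝ → ℝ, Injective φ ∧ ∀ n t, φ (n, t) ∉ D ∧ 0 < φ (n, t) ∧
        φ (n, t) < 1 / ((n : ℝ) + 1) := by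
  obtain ⟨z, hz, hz'⟩ := exists_disjoint_pairs
  have himage : ∀ i : DisplacingMap, i.toMap (z i) ∉ range z := by
    rintro i ⟨j, hj⟩
    by_cases h : j = i
    · subst h
      exact j.ne_self _ (hz j).1 hj.symm
    · exact (hz' j i h).1 hj
  have hδ : ∀ n : ℕ, (0 : ℝ) < 1 / ((n : ℝ) + 1) / 2 := fun n => by positivity
  -- Tasks whose image points supply `φ`: the interval and the shift each contribute less than half
  -- of `1 / (n + 1)`, and `Real.sigmoid` encodes `t` in the shift.
  let T : ℕ × ℝ → DisplacingMap := fun p =>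
    .translation (1 / ((p.1 : ℝ) + 1) / 2 * Real.sigmoid p.2) 0 (1 / ((p.1 : ℝ) + 1) / 2)
      (mul_pos (hδ _) (Real.sigmoid_pos _)).ne' (hδ _)
  have hT : Injective T := by
    rintro ⟨n, s⟩ ⟨m, t⟩ h
    have h1 : (1 : ℝ) / ((n : ℝ) + 1) / 2 = 1 / ((m : ℝ) + 1) / 2 :=
      congrArg DisplacingMap.right h
    have h2 : (0 : ℝ) + 1 / ((n : ℝ) + 1) / 2 * Real.sigmoid s =
        0 + 1 / ((m : ℝ) + 1) / 2 * Real.sigmoid t :=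
      congrArg (fun i : DisplacingMap => i.toMap 0) h
    rw [h1, zero_add, zero_add] at h2
    have h3 := Real.sigmoid_injective (mul_left_cancel₀ (hδ m).ne' h2)
    have h4 : n = m := by
      field_simp at h1
      exact_mod_cast (by linarith : (n : ℝ) = m)
    rw [h3, h4]
  refine ⟨range z, ?_, ?_, fun p => (T p).toMap (z (T p)), ?_, ?_⟩
  · rintro ⟨i, hi⟩
    exact (hz i).2.1 hi
  · intro f hf hinj a b hab hne
    let i : DisplacingMap := ⟨⟨f, hf⟩, a, b, hinj, hab, hne⟩
    exact ⟨z i, (hz i).1, mem_range_self i, himage i, (hz i).2.2⟩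
  · intro p q h
    by_contra hpq
    exact (hz' _ _ fun h' => hpq (hT h')).2 h
  · intro n t
    have h1 : z (T (n, t)) ∈ Ioo (0 : ℝ) (1 / ((n : ℝ) + 1) / 2) := (hz (T (n, t))).1
    have h2 : (T (n, t)).toMap (z (T (n, t))) =
      z (T (n, t)) + 1 / ((n : ℝ) + 1) / 2 * Real.sigmoid t := rfl
    have h3 := mul_pos (hδ n) (Real.sigmoid_pos t)
    have h4 := mul_lt_mul_of_pos_left (Real.sigmoid_lt_one t) (hδ n)
    refine ⟨himage _, ?_, ?_⟩ <;> simp only [h2] <;> linarith [h1.1, h1.2]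

/-! ### Counting filters -/

open scoped Classical in
/-- An independent family of subsets, indexed by `Set α`, of the set of pairs of a finite set and
a finite collection of finite sets. -/
def independentSet {α : Type*} (A : Set α) : Set (Finset α × Finset (Finset α)) :=
  {p | p.1.filter (· ∈ A) ∈ p.2}

-- A finite set containing a separating point for each two distinct members of `T` has distinct
-- traces on them; the second coordinate lists the traces of those in `𝓑`.
open scoped Classical in
theorem exists_mem_independentSet_iff {α : Type*} (𝓑 : Set (Set α)) (T : Finset (Set α)) :
    ∃ p, ∀ A ∈ T, p ∈ independentSet A ↔ A ∈ 𝓑 := by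
  have hw : ∀ A B : Set α, ∃ w : Finset α, (∀ x ∈ w, x ∈ A ↔ x ∈ B) → A = B := by
    intro A B
    by_cases h : A = B
    · exact ⟨∅, fun _ => h⟩
    · obtain ⟨x, hx⟩ : ∃ x, ¬ (x ∈ A ↔ x ∈ B) := by
        by_contra! hcon
        exact h (Set.ext hcon)
      exact ⟨{x}, fun h' => absurd (h' x (Finset.mem_singleton_self x)) hx⟩
  choose w hw using hw
  let s : Finset α := (T ×ˢ T).biUnion fun q => w q.1 q.2
  refine ⟨(s, (T.filter (· ∈ 𝓑)).image fun A => s.filter (· ∈ A)), fun A hA => ?_⟩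
  simp only [independentSet, mem_ofPred_eq, Finset.mem_image, Finset.mem_filter]
  constructor
  · rintro ⟨B, ⟨hBT, hB⟩, h⟩
    have : B = A := hw B A fun x hx => by
      have hxs : x ∈ s := Finset.mem_biUnion.2 ⟨(B, A), Finset.mk_mem_product hBT hA, hx⟩
      simpa [hxs] using Finset.ext_iff.1 h x
    exact this ▸ hB
  · intro h
    exact ⟨A, ⟨hA, h⟩, rfl⟩

/-- There are `2 ^ 2 ^ 𝔠` filters on the real line. -/
theorem exists_injective_filter_real : ∃ H : Set (Set ℝ) → Filter ℝ, Injective H := by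
  let H : Set (Set ℝ) → Filter (Finset ℝ × Finset (Finset ℝ)) := fun 𝓑 =>
    ⨅ A : Set ℝ, 𝓟 {p | p ∈ independentSet A ↔ A ∈ 𝓑}
  -- Properness gives injectivity: if `𝓑` and `𝓑'` differ at `A`, their filters contain
  -- complementary sets.
  have hne : ∀ 𝓑, (H 𝓑).NeBot := by
    intro 𝓑
    choose p hp using exists_mem_independentSet_iff 𝓑
    have : Tendsto p atTop (H 𝓑) := by
      refine tendsto_iInf.2 fun A => tendsto_principal.2 ?_
      filter_upwards [eventually_ge_atTop {A}] with T hT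
      exact hp T A (hT (Finset.mem_singleton_self A))
    exact this.neBot
  have hmem : ∀ 𝓑 A, {p | p ∈ independentSet A ↔ A ∈ 𝓑} ∈ H 𝓑 := fun 𝓑 A =>
    mem_iInf_of_mem A (mem_principal_self _)
  have hinj : Injective H := by
    intro 𝓑 𝓑' h
    ext A
    have := hne 𝓑
    obtain ⟨p, hp, hp'⟩ := Filter.nonempty_of_mem (inter_mem (hmem 𝓑 A) (h ▸ hmem 𝓑' A))
    exact hp.symm.trans hp'
  obtain ⟨e⟩ : Nonempty (Finset ℝ × Finset (Finset ℝ) ↪ ℝ) := by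
    rw [← Cardinal.le_def]
    simp [Cardinal.mk_real]
  exact ⟨fun 𝓑 => (H 𝓑).map e, fun 𝓑 𝓑' h => hinj (map_injective e.injective h)⟩

/-! ### The trace topologies -/

/-- The topology on the line in which the neighbourhoods of `x ≠ 0` are generated by the traces
on `D ∪ {x}` of the Euclidean ones, while those of `0` must in addition belong to `G`. -/
abbrev traceTopology (D : Set ℝ) (G : Filter ℝ) : TopologicalSpace ℝ where
  IsOpen U := (∀ x ∈ U, U ∈ 𝓝[D] x) ∧ ((0 : ℝ) ∈ U → U ∈ G)
  isOpen_univ := ⟨fun _ _ => univ_mem, fun _ => univ_mem⟩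
  isOpen_inter _ _ hU hV :=
    ⟨fun x hx => inter_mem (hU.1 x hx.1) (hV.1 x hx.2),
      fun h => inter_mem (hU.2 h.1) (hV.2 h.2)⟩
  isOpen_sUnion _ h :=
    ⟨fun x ⟨U, hU, hx⟩ => mem_of_superset ((h U hU).1 x hx) (subset_sUnion_of_mem hU),
      fun ⟨U, hU, hx⟩ => mem_of_superset ((h U hU).2 hx) (subset_sUnion_of_mem hU)⟩

namespace traceTopology

variable {D : Set ℝ} {G H : Filter ℝ}

theorem isOpen_of_superset {U : Set ℝ} (hU : D ⊆ U) (h0 : (0 : ℝ) ∈ U → U ∈ G) :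
    IsOpen[traceTopology D G] U :=
  ⟨fun _ _ => mem_of_superset self_mem_nhdsWithin hU, h0⟩

theorem isOpen_of_isOpen (hG : G ≤ 𝓝 0) {U : Set ℝ} (hU : IsOpen U) :
    IsOpen[traceTopology D G] U :=
  ⟨fun _ hx => mem_nhdsWithin_of_mem_nhds (hU.mem_nhds hx), fun h => hG (hU.mem_nhds h)⟩

theorem mem_refinements (hG : G ≤ 𝓝 0) : traceTopology D G ∈ refinements :=
  fun _ hU => isOpen_of_isOpen hG hU

theorem t2Space (hG : G ≤ 𝓝 0) : @T2Space ℝ (traceTopology D G) :=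
  t2Space_antitone (fun _ hU => isOpen_of_isOpen hG hU : traceTopology D G ≤ euclideanTopology)
    inferInstance

theorem separableSpace (hD : Dense D) : @TopologicalSpace.SeparableSpace ℝ (traceTopology D G) := by
  obtain ⟨C, hCD, hC, hCd⟩ := hD.exists_countable_dense_subset
  refine @TopologicalSpace.SeparableSpace.mk ℝ (traceTopology D G) ⟨C, hC, ?_⟩
  rw [@dense_iff_inter_open _ (traceTopology D G)]
  rintro U hU ⟨x, hx⟩
  obtain ⟨V, hV, hxV, hVU⟩ := mem_nhdsWithin.1 (hU.1 x hx)
  obtain ⟨y, hyV, hyC⟩ := hCd.inter_open_nonempty V hV ⟨x, hxV⟩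
  exact ⟨y, hVU ⟨hyV, hCD hyC⟩, hyC⟩

/-- The points at which a clopen set is a `D`-trace neighbourhood form a Euclidean clopen set. -/
theorem connectedSpace (hD : Dense D) : @ConnectedSpace ℝ (traceTopology D G) := by
  have hne : ∀ x, (𝓝[D] x).NeBot := fun x => mem_closure_iff_nhdsWithin_neBot.1 (hD x)
  rw [@connectedSpace_iff_clopen _ (traceTopology D G)]
  refine ⟨inferInstance, fun U ⟨hUc, hUo⟩ => ?_⟩
  have hUc : IsOpen[traceTopology D G] Uᶜ := (@isOpen_compl_iff _ _ (traceTopology D G)).2 hUc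
  have hopen : ∀ W : Set ℝ, IsOpen {x | W ∈ 𝓝[D] x} := fun W => by
    simp only [mem_nhdsWithin_iff_eventually]
    exact isOpen_setOfPred_eventually_nhds
  have hdisj : ∀ x, U ∈ 𝓝[D] x → Uᶜ ∈ 𝓝[D] x → False := fun x h h' => by
    simpa using (hne x).nonempty_of_mem (inter_mem h h')
  have hcompl : {x | Uᶜ ∈ 𝓝[D] x} = {x | U ∈ 𝓝[D] x}ᶜ := by
    ext x
    refine ⟨fun h h' => hdisj x h' h, fun h => ?_⟩
    by_cases hx : x ∈ U
    · exact absurd (hUo.1 x hx) h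
    · exact hUc.1 x hx
  have hclopen : IsClopen {x | U ∈ 𝓝[D] x} :=
    ⟨isOpen_compl_iff.1 (hcompl ▸ hopen _), hopen _⟩
  rcases isClopen_iff.1 hclopen with h | h
  · left
    refine eq_empty_of_forall_notMem fun x hx => ?_
    exact (h ▸ (hUo.1 x hx : x ∈ {x | U ∈ 𝓝[D] x}) : x ∈ (∅ : Set ℝ))
  · right
    refine eq_univ_of_forall fun x => by_contra fun hx => ?_
    exact hdisj x (h ▸ mem_univ x : x ∈ {x | U ∈ 𝓝[D] x}) (hUc.1 x hx)

theorem strictPoints_eq_univ (hD : Dense Dᶜ) (h0 : (0 : ℝ) ∉ D) (hG : Ioi 0 ∈ G) :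
    strictPoints (traceTopology D G) = univ := by
  refine eq_univ_of_forall fun x hx => ?_
  -- The positive ray, needed only at `0` to reach `G`, leaves the left side of `x` to `D` alone.
  have hopen : IsOpen[traceTopology D G] (D ∪ {x} ∪ {y | x = 0 ∧ 0 < y}) := by
    refine isOpen_of_superset (fun y hy => Or.inl (Or.inl hy)) ?_
    rintro ((h | h) | h)
    · exact absurd h h0
    · exact mem_of_superset hG fun y hy => Or.inr ⟨h.symm, hy⟩
    · exact absurd h.2 (lt_irrefl _)
  have hmem : D ∪ {x} ∪ {y | x = 0 ∧ 0 < y} ∈ 𝓝 x := by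
    have := @IsOpen.mem_nhds _ (traceTopology D G) x _ hopen (Or.inl (Or.inr rfl))
    rwa [← hx] at this
  obtain ⟨ε, hε, hball⟩ := Metric.mem_nhds_iff.1 hmem
  obtain ⟨y, hy, hyD⟩ := hD.inter_open_nonempty (Ioo (x - ε) x) isOpen_Ioo
    (nonempty_Ioo.2 (by linarith))
  have hyx : y ∈ Metric.ball x ε := by
    rw [Real.ball_eq_Ioo]
    exact ⟨hy.1, hy.2.trans (by linarith)⟩
  rcases hball hyx with (h | h) | h
  · exact hyD h
  · exact hy.2.ne h
  · exact absurd hy.2 (by rw [h.1]; exact h.2.not_gt)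

/-- Since `H` avoids `D ∪ {0}`, openness of `D ∪ {0} ∪ A` detects whether `A` belongs to the filter.
-/
theorem le_of_eq (hH : Dᶜ ∩ {0}ᶜ ∈ H)
    (h : traceTopology D G = traceTopology D H) : H ≤ G := by
  intro A hA
  have hopen : IsOpen[traceTopology D G] (D ∪ {0} ∪ A) :=
    isOpen_of_superset (fun y hy => Or.inl (Or.inl hy)) fun _ =>
      mem_of_superset hA subset_union_right
  rw [h] at hopen
  filter_upwards [hopen.2 (Or.inl (Or.inr rfl)), hH] with y hy hy'
  rcases hy with (hy | hy) | hy
  · exact absurd hy hy'.1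
  · exact absurd hy hy'.2
  · exact hy

/-- A continuous map between such topologies is continuous for the Euclidean topology. -/
theorem continuous_euclidean (hD : Dense D) (hH : H ≤ 𝓝 0) {f : ℝ → ℝ}
    (hf : @Continuous ℝ ℝ (traceTopology D G) (traceTopology D H) f) : Continuous f := by
  have hlim : ∀ x, Tendsto f (𝓝[D] x) (𝓝 (f x)) := by
    intro x
    refine tendsto_nhds.2 fun V hV hx => ?_
    exact ((@continuous_def _ _ (traceTopology D G) (traceTopology D H) f).1 hf V
      (isOpen_of_isOpen hH hV)).1 x hx
  -- Limits along a dense set into a regular space extend continuously, and `f` is its own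
  -- extension.
  have hcont := continuous_extendFrom hD fun x => ⟨_, hlim x⟩
  have heq : extendFrom D f = f := funext fun x => extendFrom_eq (hD x) (hlim x)
  rwa [heq] at hcont

/-- If `D` is rigid, the identity is the only continuous injection between such topologies. -/
theorem eq_id_of_continuous (hD : Dense D) (h0 : (0 : ℝ) ∉ D) (hH : H ≤ 𝓝 0)
    (hrigid : ∀ f : ℝ → ℝ, Continuous f → Injective f → ∀ a b, a < b →
      (∀ x ∈ Ioo a b, f x ≠ x) → ∃ x ∈ Ioo a b, x ∈ D ∧ f x ∉ D ∧ f x ≠ 0)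
    {f : ℝ → ℝ} (hf : @Continuous ℝ ℝ (traceTopology D G) (traceTopology D H) f)
    (hinj : Injective f) : f = id := by
  have hc := continuous_euclidean hD hH hf
  by_contra hne
  obtain ⟨x₀, hx₀⟩ : ∃ x, f x ≠ x := by
    by_contra! h
    exact hne (funext h)
  obtain ⟨ε, hε, hball⟩ := Metric.mem_nhds_iff.1
    ((isOpen_ne_fun hc continuous_id).mem_nhds hx₀)
  rw [Real.ball_eq_Ioo] at hball
  obtain ⟨x, hx, -, hfx, hfx0⟩ := hrigid f hc hinj _ _ (by linarith) fun y hy => hball hy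
  have hopen : IsOpen[traceTopology D H] (D ∪ {f x}) :=
    isOpen_of_superset subset_union_left fun h => by
      rcases h with h | h
      · exact absurd h h0
      · exact absurd h.symm hfx0
  have hpre := ((@continuous_def _ _ (traceTopology D G) (traceTopology D H) f).1 hf _ hopen).1 x
    (Or.inr rfl)
  obtain ⟨V, hV, hxV, hVf⟩ := mem_nhdsWithin.1 hpre
  obtain ⟨δ, hδ, hδV⟩ := Metric.mem_nhds_iff.1 (hV.mem_nhds hxV)
  rw [Real.ball_eq_Ioo] at hδV
  -- Near `x`, continuity sends `D` into `D ∪ {f x}`. A second use of rigidity just to the right of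
  -- `x` gives `y ∈ D` with `f y ∉ D`, and `f y ≠ f x` by injectivity.
  obtain ⟨y, hy, hyD, hfy, -⟩ := hrigid f hc hinj x (min (x + δ) (x₀ + ε))
    (lt_min (by linarith) hx.2) fun y hy => hball
      ⟨hx.1.trans hy.1, hy.2.trans_le (min_le_right _ _)⟩
  have hyV : y ∈ V := hδV ⟨by linarith [hy.1], hy.2.trans_le (min_le_left _ _)⟩
  rcases hVf ⟨hyV, hyD⟩ with h | h
  · exact hfy h
  · exact hy.1.ne' (hinj h)

theorem eq_of_homeomorph (hD : Dense D) (h0 : (0 : ℝ) ∉ D) (hH : H ≤ 𝓝 0)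
    (hrigid : ∀ f : ℝ → ℝ, Continuous f → Injective f → ∀ a b, a < b →
      (∀ x ∈ Ioo a b, f x ≠ x) → ∃ x ∈ Ioo a b, x ∈ D ∧ f x ∉ D ∧ f x ≠ 0) {S : Set ℝ}
    (e : @Homeomorph ℝ S (traceTopology D G)
      (TopologicalSpace.induced Subtype.val (traceTopology D H))) :
    traceTopology D G = traceTopology D H ∧ S = univ := by
  have hind := @Homeomorph.isInducing _ _ (traceTopology D G) (_) e
  have hcont := @Homeomorph.continuous _ _ (traceTopology D G) (_) e
  have hinj := @Homeomorph.injective _ _ (traceTopology D G) (_) e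
  have hid : (fun x => (e x : ℝ)) = id :=
    eq_id_of_continuous hD h0 hH hrigid
      (@Continuous.comp _ _ _ (traceTopology D G) (_) (traceTopology D H) _ _
        (@continuous_induced_dom _ _ _ (traceTopology D H)) hcont)
      (Subtype.val_injective.comp hinj)
  refine ⟨?_, eq_univ_of_forall fun x => ?_⟩
  · have h := @Topology.IsInducing.eq_induced _ _ (_) (_) _ hind
    refine h.trans ((@induced_compose _ _ _ (traceTopology D H) _ _).trans ?_)
    change TopologicalSpace.induced (fun x => (e x : ℝ)) _ = _
    rw [hid]
    exact @induced_id _ (traceTopology D H)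
  · have h : (e x : ℝ) = x := congrFun hid x
    exact h ▸ (e x).2

end traceTopology

/-! ### Assembling the family -/

theorem theorem6 :
    ∃ 𝒮 : Set (TopologicalSpace ℝ),
      Cardinal.mk 𝒮 = (2 : Cardinal.{0}) ^ ((2 : Cardinal.{0}) ^ Cardinal.continuum.{0}) ∧
      (∀ τ ∈ 𝒮, τ ∈ refinements ∧ strictPoints τ = Set.univ ∧
        @T2Space ℝ τ ∧ @TopologicalSpace.SeparableSpace ℝ τ ∧ @ConnectedSpace ℝ τ) ∧
      Incomparable 𝒮 := by
  obtain ⟨D, h0, hrigid, φ, hφ, hφD⟩ := exists_rigid_set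
  obtain ⟨F, hF⟩ := exists_injective_filter_real
  have htask : ∀ a b : ℝ, a < b → ∃ x ∈ Ioo a b, x ∈ D ∧ x + (b - a) ∉ D := fun a b hab => by
    obtain ⟨x, hx, hxD, hx', -⟩ := hrigid (· + (b - a)) (by fun_prop)
      (add_left_injective _) a b hab fun x _ => by simpa using (sub_pos.2 hab).ne'
    exact ⟨x, hx, hxD, hx'⟩
  have hD : Dense D := dense_iff_exists_between.2 fun {a b} hab => by
    obtain ⟨x, hx, hxD, -⟩ := htask a b hab
    exact ⟨x, hxD, hx⟩
  have hDc : Dense Dᶜ := dense_iff_exists_between.2 fun {a b} hab => by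
    obtain ⟨x, hx, -, hxD⟩ := htask a ((a + b) / 2) (by linarith)
    exact ⟨_, hxD, by linarith [hx.1], by linarith [hx.2]⟩
  -- The `ℕ`-coordinate forces convergence to `0`; the real coordinate carries an arbitrary filter,
  -- recovered by projection.
  let G : Set (Set ℝ) → Filter ℝ := fun 𝓑 => map φ (atTop ×ˢ F 𝓑)
  have hGrange : ∀ 𝓑 (s : Set ℝ), (∀ n t, φ (n, t) ∈ s) → s ∈ G 𝓑 := fun 𝓑 s h =>
    mem_map.2 (univ_mem' fun p => h p.1 p.2)
  have hG0 : ∀ 𝓑, G 𝓑 ≤ 𝓝 0 := fun 𝓑 => by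
    have h : Tendsto (fun p : ℕ × ℝ => 1 / ((p.1 : ℝ) + 1)) (atTop ×ˢ F 𝓑) (𝓝 0) :=
      tendsto_one_div_add_atTop_nhds_zero_nat.comp tendsto_fst
    exact squeeze_zero (fun p => (hφD p.1 p.2).2.1.le) (fun p => (hφD p.1 p.2).2.2.le) h
  have hGpos : ∀ 𝓑, Ioi 0 ∈ G 𝓑 := fun 𝓑 => hGrange 𝓑 _ fun n t => (hφD n t).2.1
  have hGD : ∀ 𝓑, Dᶜ ∩ {0}ᶜ ∈ G 𝓑 := fun 𝓑 => hGrange 𝓑 _ fun n t =>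
    ⟨(hφD n t).1, (hφD n t).2.1.ne'⟩
  have hGinj : Injective G := fun 𝓑 𝓑' h => by
    have := congrArg (map Prod.snd) (map_injective hφ h)
    rw [map_snd_prod, map_snd_prod] at this
    exact hF this
  have hinj : Injective fun 𝓑 => traceTopology D (G 𝓑) := fun 𝓑 𝓑' h =>
    hGinj (le_antisymm (traceTopology.le_of_eq (hGD _) h.symm)
      (traceTopology.le_of_eq (hGD _) h))
  refine ⟨range fun 𝓑 => traceTopology D (G 𝓑), ?_, ?_, ?_⟩
  · rw [Cardinal.mk_range_eq _ hinj, Cardinal.mk_set, Cardinal.mk_set, Cardinal.mk_real]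
  · rintro _ ⟨𝓑, rfl⟩
    exact ⟨traceTopology.mem_refinements (hG0 𝓑),
      traceTopology.strictPoints_eq_univ hDc h0 (hGpos 𝓑), traceTopology.t2Space (hG0 𝓑),
      traceTopology.separableSpace hD, traceTopology.connectedSpace hD⟩
  · rintro _ ⟨𝓑, rfl⟩ _ ⟨𝓑', rfl⟩ S ⟨e⟩
    exact traceTopology.eq_of_homeomorph hD h0 (hG0 𝓑') hrigid e
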